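/- A Hadamard matrix of order $n$ is an $n\times n$ matrix $H$ with all entries in $\{1,-1\}$ such that $HH^\top=nI_n$. A weighing matrix of order $n$ and weight $k$ is an $n\times n$ matrix $W$ with all entries in $\{0,1,-1\}$ such that $WW^\top=kI_n$; thus a Hadamard matrix of order $n$ is a weighing matrix of order $n$ and weight $n$. For a real number $a>0$, two weighing matrices $W_1,W_2$ of order $n$ and weight $k$ are quasi-unbiased for parameters $(n,k,l,a)$ if $\frac{1}{\sqrt a}W_1W_2^\top$ is a weighing matrix of order $n$ and weight $l$; weighing matrices $W_1,\dots,W_f$ of order $n$ and weight $k$ are mutually quasi-unbiased for parameters $(n,k,l,a)$ if any two of them with distinct indices are quasi-unbiased for these parameters. Theorem. For every prime number $q$ there is a positive integer $t$ such that there exist $2^t$ distinct Hadamard matrices of order $2^{2t}q$ that are mutually quasi-unbiased for the parameters $(2^{2t}q,\,2^{2t}q,\,2^{2t},\,2^{2t}q^2)$. -/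

import Mathlib

open Matrix

/-- A weighing matrix of order `n` and weight `k`: a real `(0, 1, -1)`-matrix `W` of size `n × n`
with `W Wᵀ = k I`. -/
structure IsWeighing {n : ℕ} (k : ℕ) (W : Matrix (Fin n) (Fin n) ℝ) : Prop where
  entries : ∀ i j, W i j = 0 ∨ W i j = 1 ∨ W i j = -1
  mul_transpose : W * Wᵀ = (k : ℝ) • (1 : Matrix (Fin n) (Fin n) ℝ)

/-- `W₁, W₂` are weighing matrices of order `n` and weight `k` that are quasi-unbiased for the
parameters `(n, k, l, a)`, with `a` a positive real:
`(1 / √a) W₁ W₂ᵀ` is a weighing matrix of order `n` and weight `l`. -/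
structure QuasiUnbiased (n k l : ℕ) (a : ℝ) (W₁ W₂ : Matrix (Fin n) (Fin n) ℝ) : Prop where
  pos : 0 < a
  left : IsWeighing k W₁
  right : IsWeighing k W₂
  weighing : IsWeighing l ((1 / Real.sqrt a) • (W₁ * W₂ᵀ))

/-- `W` is a family of weighing matrices of order `n` and weight `k`, any two of which (at
distinct indices) are quasi-unbiased for the parameters `(n, k, l, a)`. -/
structure MutuallyQuasiUnbiased {ι : Type*} (n k l : ℕ) (a : ℝ)
    (W : ι → Matrix (Fin n) (Fin n) ℝ) : Prop where
  weighing : ∀ i, IsWeighing k (W i)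
  pairwise : ∀ i j, i ≠ j → QuasiUnbiased n k l a (W i) (W j)

/-!
The family is a sheared block construction. Let `F` be the field with `2 ^ t` elements, `R` a
Hadamard matrix with rows and columns indexed by `F`, and `K` a Hadamard matrix of order `2 ^ t * q`
with rows indexed by `F × Fin q`. For `x : F`, the matrix `shear R K x` has block rows `(u, v)` and
block columns `k : F`, the block at `((u, v), k)` being the outer product of column `k` of `R` with
the row `(u + x * k, v)` of `K`. Since rows of `K` are orthogonal, two blocks in the same block
column interact only when they use the same row of `K`. For `x = y` this forces equal block rows,
and `shear R K x` is Hadamard (`shear_gram`). For `x ≠ y` the equation `u + x * k = u' + y * k` has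
exactly one solution `k`, so an entry of `shear R K x * (shear R K y)ᵀ` is `0` or `± 2 ^ t * q`
(`shear_cross_entry`). The weight of this product is then forced by `Hᵀ * H = n • 1`.

This needs a Hadamard matrix of order `2 ^ t * q` for some `t`, a theorem of Seberry. A *full
design* `HasDesign s a b c` is a rule that turns three pairwise amicable sign matrices satisfying
`a • A Aᵀ + b • B Bᵀ + c • C Cᵀ = N • 1` into a Hadamard matrix of order `2 ^ s` times as large. It
exists whenever `a + b + c = 2 ^ s` (`HasDesign.of_sum_eq`): if all three weights are even they can
be halved, and otherwise exactly two are odd, and the larger of these is split off the smaller by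
the substitution of a 2 by 2 block. For `q` odd it is fed with the all-ones matrix `J`, with
`J - 2 • 1`, and with two Paley matrices built from the quadratic character, whose Gram matrices add
up to `2 * (q + 1) • 1 - 2 • J`. The coefficient of `J` vanishes as soon as
`a * (q + 1) + b * (q - 3) = 2 ^ s`, which is solvable for large `s` because
`gcd (q + 1) (q - 3)` divides `4`.
-/

/-! ### Sign matrices and Hadamard orders -/

/-- A real matrix all of whose entries are `1` or `-1`. -/
def IsSignMatrix {m n : Type*} (A : Matrix m n ℝ) : Prop :=
  ∀ i j, A i j = 1 ∨ A i j = -1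

/-- There is a real Hadamard matrix of order `k`. -/
def HadamardOrder (k : ℕ) : Prop :=
  ∃ H : Matrix (Fin k) (Fin k) ℝ, H.IsHadamard

theorem IsSignMatrix.mul_self {m n : Type*} {A : Matrix m n ℝ} (hA : IsSignMatrix A) (i : m)
    (j : n) : A i j * A i j = 1 := by
  rcases hA i j with h | h <;> simp [h]

theorem isHadamard_of_mul_transpose {n : Type*} [Fintype n] [DecidableEq n] [Nonempty n]
    {A : Matrix n n ℝ} (hA : IsSignMatrix A) (h : A * Aᵀ = (Fintype.card n : ℝ) • 1) :
    A.IsHadamard := by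
  refine IsHadamard.of_mul_conjTranspose (fun i j => ?_) (by simpa using h)
    (IsRegular.of_ne_zero (by exact_mod_cast Fintype.card_ne_zero))
  rcases hA i j with h | h <;> simp [h, Unitary.mem_iff]

theorem isSignMatrix_of_isHadamard {n : Type*} [Fintype n] [DecidableEq n]
    {A : Matrix n n ℝ} (hA : A.IsHadamard) : IsSignMatrix A := fun i j => by
  have h := (Unitary.mem_iff.1 (hA.apply_mem i j)).1
  simp only [star_trivial] at h
  exact mul_self_eq_one_iff.1 h

theorem HadamardOrder.exists_index {k : ℕ} (h : HadamardOrder k) (n : Type*) [Fintype n]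
    [DecidableEq n] (hn : Fintype.card n = k) :
    ∃ H : Matrix n n ℝ, IsSignMatrix H ∧ H * Hᵀ = (k : ℝ) • 1 := by
  obtain ⟨H, hH⟩ := h
  have e : Fin k ≃ n := Fintype.equivOfCardEq (by simp [hn])
  have := hH.reindex e e
  exact ⟨_, isSignMatrix_of_isHadamard this, by simpa [hn] using this.mul_conjTranspose⟩

/-! ### Doubling the size by block substitution -/

section Blocks

variable {m : Type*}

/-- The Kronecker product of the Hadamard matrix of order `2` with `A`. It doubles the weight of
`A` in a Gram matrix and preserves amicability. -/
def dup (A : Matrix m m ℝ) : Matrix (m ⊕ m) (m ⊕ m) ℝ := fromBlocks A A A (-A)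

/-- The substitution of `A` and `B` into the 2 by 2 orthogonal design in two variables. -/
def rot (A B : Matrix m m ℝ) : Matrix (m ⊕ m) (m ⊕ m) ℝ := fromBlocks A B (-B) A

theorem IsSignMatrix.dup {A : Matrix m m ℝ} (hA : IsSignMatrix A) : IsSignMatrix (dup A) := by
  rintro (i | i) (j | j) <;> rcases hA i j with h | h <;> simp [_root_.dup, h]

theorem IsSignMatrix.rot {A B : Matrix m m ℝ} (hA : IsSignMatrix A) (hB : IsSignMatrix B) :
    IsSignMatrix (rot A B) := by
  rintro (i | i) (j | j) <;> rcases hA i j with h | h <;> rcases hB i j with h' | h' <;>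
    simp [_root_.rot, h, h']

variable [Fintype m]

theorem dup_mul_transpose_dup (A B : Matrix m m ℝ) :
    dup A * (dup B)ᵀ = fromBlocks ((2 : ℝ) • (A * Bᵀ)) 0 0 ((2 : ℝ) • (A * Bᵀ)) := by
  simp [dup, fromBlocks_transpose, fromBlocks_multiply, two_smul]

theorem rot_mul_transpose_rot {A B : Matrix m m ℝ} (h : A * Bᵀ = B * Aᵀ) :
    rot A B * (rot A B)ᵀ = fromBlocks (A * Aᵀ + B * Bᵀ) 0 0 (A * Aᵀ + B * Bᵀ) := by
  simp [rot, fromBlocks_transpose, fromBlocks_multiply, h, add_comm]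

/-- Amicability of matrices `X`, `Y` means that `X * Yᵀ` is symmetric, that is,
`X * Yᵀ = Y * Xᵀ`. -/
theorem rot_dup_amicable {A B C : Matrix m m ℝ} (hA : A * Cᵀ = C * Aᵀ) (hB : B * Cᵀ = C * Bᵀ) :
    rot A B * (dup C)ᵀ = dup C * (rot A B)ᵀ := by
  simp [rot, dup, fromBlocks_transpose, fromBlocks_multiply, hA, hB, add_comm]

theorem dup_dup_amicable {A B : Matrix m m ℝ} (h : A * Bᵀ = B * Aᵀ) :
    dup A * (dup B)ᵀ = dup B * (dup A)ᵀ := by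
  simp [dup_mul_transpose_dup, h]

end Blocks

/-! ### Full designs in three variables -/

/-- The existence of a full orthogonal design of order `2 ^ s` and type `(a, b, c)`, encoded by what
such a design is used for: given pairwise amicable sign matrices `A`, `B`, `C` of order `m` whose Gram
matrices, weighted by `a`, `b`, `c`, add up to a scalar matrix, there is a Hadamard matrix of order
`2 ^ s * m`. Quantifying over all index types `m` lets a design be doubled by applying it to block
matrices on `m ⊕ m`. -/
def HasDesign (s a b c : ℕ) : Prop :=
  ∀ (m : Type) [Fintype m] [DecidableEq m] [Nonempty m] (A B C : Matrix m m ℝ),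
    IsSignMatrix A → IsSignMatrix B → IsSignMatrix C →
    A * Bᵀ = B * Aᵀ → A * Cᵀ = C * Aᵀ → B * Cᵀ = C * Bᵀ →
    ∀ N : ℝ, (a : ℝ) • (A * Aᵀ) + (b : ℝ) • (B * Bᵀ) + (c : ℝ) • (C * Cᵀ) = N • 1 →
    HadamardOrder (2 ^ s * Fintype.card m)

namespace HasDesign

variable {s a b c : ℕ}

theorem swap_left (h : HasDesign s a b c) : HasDesign s b a c :=
  fun m _ _ _ A B C hA hB hC hAB hAC hBC N hN =>
    h m B A C hB hA hC hAB.symm hBC hAC N (by rw [← hN]; abel)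

theorem swap_right (h : HasDesign s a b c) : HasDesign s a c b :=
  fun m _ _ _ A B C hA hB hC hAB hAC hBC N hN =>
    h m A C B hA hC hB hAC hAB hBC.symm N (by rw [← hN]; abel)

/-- The base case: the only variable that occurs is itself a Hadamard matrix. -/
theorem single : HasDesign 0 1 0 0 := by
  intro m _ _ _ A B C hA _ _ _ _ _ N hN
  have hN' : A * Aᵀ = N • 1 := by simpa using hN
  have hcard : N = Fintype.card m := by
    obtain ⟨i⟩ := ‹Nonempty m›
    have := congrFun (congrFun hN' i) i
    simpa [Matrix.mul_apply, hA.mul_self] using this.symm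
  have hH := isHadamard_of_mul_transpose hA (hcard ▸ hN')
  rw [pow_zero, one_mul]
  exact ⟨_, hH.reindex (Fintype.equivFin m) (Fintype.equivFin m)⟩

theorem double (h : HasDesign s a b c) : HasDesign (s + 1) (2 * a) (2 * b) (2 * c) := by
  intro m _ _ _ A B C hA hB hC hAB hAC hBC N hN
  have := h (m ⊕ m) (dup A) (dup B) (dup C) hA.dup hB.dup hC.dup (dup_dup_amicable hAB)
    (dup_dup_amicable hAC) (dup_dup_amicable hBC) N (by
      simp only [dup_mul_transpose_dup, fromBlocks_smul, fromBlocks_add, ← fromBlocks_one,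
        smul_zero, add_zero]
      push_cast at hN
      rw [← hN]
      congr 1 <;> module)
  simpa [pow_succ, mul_assoc, two_mul] using this

/-- Replacing the first variable by `rot A B` and the others by `dup B`, `dup C` moves weight from
the first variable to the second. -/
theorem split (h : HasDesign s a b c) : HasDesign (s + 1) a (a + 2 * b) (2 * c) := by
  intro m _ _ _ A B C hA hB hC hAB hAC hBC N hN
  have := h (m ⊕ m) (rot A B) (dup B) (dup C) (hA.rot hB) hB.dup hC.dup
    (rot_dup_amicable hAB rfl) (rot_dup_amicable hAC hBC) (dup_dup_amicable hBC) N (by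
      simp only [dup_mul_transpose_dup, rot_mul_transpose_rot hAB, fromBlocks_smul,
        fromBlocks_add, ← fromBlocks_one, smul_zero, add_zero]
      push_cast at hN
      rw [← hN]
      congr 1 <;> module)
  simpa [pow_succ, mul_assoc, two_mul] using this

theorem split_of_le {s a b c : ℕ} (ih : ∀ a b c, a + b + c = 2 ^ s → HasDesign s a b c)
    (h : a + b + c = 2 ^ (s + 1)) (ha : a % 2 = 1) (hb : b % 2 = 1) (hab : a ≤ b) :
    HasDesign (s + 1) a b c := by
  rw [pow_succ] at h
  have := (ih a ((b - a) / 2) (c / 2) (by omega)).split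
  rwa [show a + 2 * ((b - a) / 2) = b by omega, show 2 * (c / 2) = c by omega] at this

theorem split_of_odd {s a b c : ℕ} (ih : ∀ a b c, a + b + c = 2 ^ s → HasDesign s a b c)
    (h : a + b + c = 2 ^ (s + 1)) (ha : a % 2 = 1) (hb : b % 2 = 1) :
    HasDesign (s + 1) a b c := by
  rcases le_total a b with hab | hab
  · exact split_of_le ih h ha hb hab
  · exact (split_of_le ih (by omega) hb ha hab).swap_left

/-- Every weight triple with sum `2 ^ s` is realised by a full design of order `2 ^ s`. -/
theorem of_sum_eq (s : ℕ) : ∀ a b c, a + b + c = 2 ^ s → HasDesign s a b c := by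
  induction s with
  | zero =>
    intro a b c h
    rw [pow_zero] at h
    obtain ⟨rfl, rfl, rfl⟩ | ⟨rfl, rfl, rfl⟩ | ⟨rfl, rfl, rfl⟩ :
        (a = 1 ∧ b = 0 ∧ c = 0) ∨ (a = 0 ∧ b = 1 ∧ c = 0) ∨ (a = 0 ∧ b = 0 ∧ c = 1) := by omega
    · exact single
    · exact single.swap_left
    · exact single.swap_left.swap_right
  | succ s ih =>
    intro a b c h
    have h' := h
    rw [pow_succ] at h'
    obtain ha | ha := Nat.mod_two_eq_zero_or_one a <;>
      obtain hb | hb := Nat.mod_two_eq_zero_or_one b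
    · have := (ih (a / 2) (b / 2) (c / 2) (by omega)).double
      rwa [show 2 * (a / 2) = a by omega, show 2 * (b / 2) = b by omega,
        show 2 * (c / 2) = c by omega] at this
    · exact (split_of_odd ih (by omega) hb (by omega : c % 2 = 1)
        : HasDesign (s + 1) b c a).swap_right.swap_left
    · exact (split_of_odd ih (by omega) ha (by omega : c % 2 = 1)
        : HasDesign (s + 1) a c b).swap_right
    · exact split_of_odd ih h ha hb

end HasDesign

/-- Sylvester's Hadamard matrices, as designs in a single variable of order `1`. -/
theorem hadamardOrder_two_pow (s : ℕ) : HadamardOrder (2 ^ s) := by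
  have h1 : IsSignMatrix (1 : Matrix Unit Unit ℝ) := fun _ _ => by simp
  simpa using HasDesign.of_sum_eq s (2 ^ s) 0 0 (by simp) Unit 1 1 1 h1 h1 h1 rfl rfl rfl
    (2 ^ s) (by simp)

/-! ### Paley matrices and Hadamard matrices of order a power of two times `q` -/

section Paley

variable {F : Type} [Field F] [Fintype F] [DecidableEq F]

/-- The autocorrelation of the quadratic character; off the diagonal it is a Jacobi sum. -/
theorem sum_quadraticChar_mul_shift (hF : ringChar F ≠ 2) (x y : F) :
    ∑ z, (quadraticChar F (x + z) * quadraticChar F (y + z) : ℝ) =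
      (Fintype.card F : ℝ) * (if x = y then 1 else 0) - 1 := by
  split_ifs with hxy
  · subst hxy
    have h : ∀ z : F, (quadraticChar F z * quadraticChar F z : ℝ) = 1 - if z = 0 then 1 else 0 := by
      intro z
      split_ifs with hz
      · simp [hz]
      · have := quadraticChar_sq_one hz
        rw [pow_two] at this
        rw [sub_zero]
        exact_mod_cast this
    rw [Fintype.sum_equiv (Equiv.addLeft x) (fun z => (quadraticChar F (x + z) *
      quadraticChar F (x + z) : ℝ)) (fun z => (quadraticChar F z * quadraticChar F z : ℝ))
      (fun z => rfl)]
    simp only [h, Finset.sum_sub_distrib, Finset.sum_ite_eq', Finset.mem_univ, if_true]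
    simp
  · have hd : y - x ≠ 0 := sub_ne_zero.2 (Ne.symm hxy)
    have hJ : jacobiSum (quadraticChar F) (quadraticChar F) = -quadraticChar F (-1) := by
      have := jacobiSum_nontrivial_inv (quadraticChar_ne_one hF)
      rwa [(quadraticChar_isQuadratic F).inv] at this
    have hsq : quadraticChar F (-1) * quadraticChar F (-1) = 1 := by
      rw [← pow_two]; exact quadraticChar_sq_one (by simp)
    have hsq' : quadraticChar F (y - x) * quadraticChar F (y - x) = 1 := by
      rw [← pow_two]; exact quadraticChar_sq_one hd
    have key : ∑ z, (quadraticChar F (x + z) * quadraticChar F (y + z)) = -1 := by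
      -- The substitution `x + z = -(y - x) * w` turns the sum into a Jacobi sum.
      let e : F ≃ F := (Equiv.mulLeft₀ (-(y - x)) (neg_ne_zero.2 hd)).trans (Equiv.addRight (-x))
      rw [← Fintype.sum_equiv e (fun w => quadraticChar F (-1) *
        (quadraticChar F w * quadraticChar F (1 - w))) _ ?_]
      · rw [← Finset.mul_sum]
        change _ * jacobiSum _ _ = _
        rw [hJ, mul_neg, hsq]
      · intro w
        have h1 : x + e w = -1 * (y - x) * w := by simp [e]
        have h2 : y + e w = (y - x) * (1 - w) := by simp [e]; ring
        rw [h1, h2, map_mul, map_mul, map_mul]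
        linear_combination (-quadraticChar F (-1) * quadraticChar F w * quadraticChar F (1 - w)) * hsq'
    simp only [mul_zero, zero_sub]
    exact_mod_cast key


variable (F) in
/-- The Paley matrix `P + e Q`, where `P` is the permutation matrix of `x ↦ -x` and `Q` has entries
`χ (x + y)` for the quadratic character `χ`. As the entries depend on `x + y` and not on `x - y`, the
matrix is symmetric whatever the value of `χ (-1)`. -/
def paley (e : ℝ) : Matrix F F ℝ :=
  of fun x y => (if x + y = 0 then 1 else 0) + e * quadraticChar F (x + y)

theorem isSignMatrix_paley {e : ℝ} (he : e * e = 1) : IsSignMatrix (paley F e) := by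
  intro x y
  have he' := mul_self_eq_one_iff.1 he
  by_cases h : x + y = 0
  · simp [paley, h]
  · rcases he' with rfl | rfl <;> rcases quadraticChar_dichotomy h with h' | h' <;>
      simp [paley, h, h', -quadraticChar_apply]

theorem paley_transpose (e : ℝ) : (paley F e)ᵀ = paley F e := by
  ext x y
  simp [paley, add_comm]

theorem paley_mul_paley (hF : ringChar F ≠ 2) (e f : ℝ) (x y : F) :
    (paley F e * (paley F f)ᵀ) x y = (if x = y then 1 else 0) + f * quadraticChar F (y - x) +
      e * quadraticChar F (x - y) + e * f * (Fintype.card F * (if x = y then 1 else 0) - 1) := by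
  have h : ∀ z, x + z = 0 ↔ z = -x := fun z => by rw [add_comm, add_eq_zero_iff_eq_neg]
  have h' : ∀ z, y + z = 0 ↔ z = -y := fun z => by rw [add_comm, add_eq_zero_iff_eq_neg]
  rw [← sum_quadraticChar_mul_shift hF, Finset.mul_sum, Matrix.mul_apply]
  simp only [paley, of_apply, transpose_apply, h, h', add_mul, mul_add, Finset.sum_add_distrib,
    ite_mul, mul_ite, one_mul, mul_one, zero_mul, mul_zero, Finset.sum_ite_eq',
    Finset.mem_univ, if_true]
  simp only [neg_inj, eq_comm (a := y), ← sub_eq_add_neg]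
  have : ∀ z, e * (quadraticChar F (x + z) : ℝ) * (f * quadraticChar F (y + z)) =
      e * f * (quadraticChar F (x + z) * quadraticChar F (y + z)) := fun z => by ring
  simp only [this]
  ring

theorem sum_paley (hF : ringChar F ≠ 2) (e : ℝ) (x : F) : ∑ z, paley F e x z = 1 := by
  have h : ∀ z, x + z = 0 ↔ z = -x := fun z => by rw [add_comm, add_eq_zero_iff_eq_neg]
  have h0 : ∑ z, (quadraticChar F (x + z) : ℝ) = 0 := by
    rw [Fintype.sum_equiv (Equiv.addLeft x) (fun z => (quadraticChar F (x + z) : ℝ))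
      (fun z => (quadraticChar F z : ℝ)) (fun z => rfl)]
    exact_mod_cast quadraticChar_sum_zero hF
  simp [paley, h, Finset.sum_add_distrib, ← Finset.mul_sum, h0, -quadraticChar_apply]

theorem quadraticChar_neg_one_mul_self :
    (quadraticChar F (-1) : ℝ) * quadraticChar F (-1) = 1 := by
  have := quadraticChar_sq_one (F := F) (a := -1) (by simp)
  rw [pow_two] at this
  exact_mod_cast this

theorem quadraticChar_sub_comm (x y : F) :
    (quadraticChar F (y - x) : ℝ) = quadraticChar F (-1) * quadraticChar F (x - y) := by
  rw [← neg_sub, ← neg_one_mul (x - y), map_mul]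
  push_cast
  rfl

/-- With signs `1` and `-χ (-1)` the two Paley matrices are amicable, and the terms linear in `χ`
cancel from the sum of their Gram matrices (`paley_gram_add`). This is so for both values of
`χ (-1)`. -/
theorem paley_amicable (hF : ringChar F ≠ 2) :
    paley F 1 * (paley F (-quadraticChar F (-1)))ᵀ =
      paley F (-quadraticChar F (-1)) * (paley F 1)ᵀ := by
  ext x y
  rw [paley_mul_paley hF, paley_mul_paley hF, quadraticChar_sub_comm x y]
  have := quadraticChar_neg_one_mul_self (F := F)
  linear_combination -(quadraticChar F (x - y) : ℝ) * this

theorem paley_gram_add (hF : ringChar F ≠ 2) :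
    paley F 1 * (paley F 1)ᵀ + paley F (-quadraticChar F (-1)) *
      (paley F (-quadraticChar F (-1)))ᵀ =
      (2 * (Fintype.card F + 1) : ℝ) • (1 : Matrix F F ℝ) - (2 : ℝ) • of fun _ _ => 1 := by
  ext x y
  rw [Matrix.add_apply, paley_mul_paley hF, paley_mul_paley hF, quadraticChar_sub_comm x y]
  have := quadraticChar_neg_one_mul_self (F := F)
  simp only [Matrix.sub_apply, Matrix.smul_apply, Matrix.one_apply, of_apply, smul_eq_mul]
  linear_combination (Fintype.card F * (if x = y then 1 else 0) - 1 -
    (quadraticChar F (x - y) : ℝ)) * this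

/-- Seberry's theorem: for every odd prime power `q` some power of two times `q` is the order of a
Hadamard matrix. -/
theorem exists_hadamardOrder_of_ringChar_ne_two (hF : ringChar F ≠ 2) :
    ∃ s, HadamardOrder (2 ^ (s + 1) * Fintype.card F) := by
  set q := Fintype.card F with hq
  have hq3 : 3 ≤ q := by
    have h1 : 1 < q := Fintype.one_lt_card
    have h2 := FiniteField.odd_card_of_char_ne_two hF
    omega
  -- The first equation makes the coefficient of the all-ones matrix vanish at the end.
  obtain ⟨s, a, b, c, hab, habc⟩ : ∃ s a b c : ℕ,
      a * (q + 1) + b * (q - 3) = 2 ^ s ∧ a + b + c = 2 ^ s := by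
    obtain h3 | hq4 : q = 3 ∨ 4 ≤ q := by omega
    · exact ⟨2, 1, 0, 3, by simp [h3], by norm_num⟩
    -- A large power of two is a nonnegative combination of `q + 1` and `q - 3`, whose gcd divides `4`.
    · have hdvd : (q + 1).gcd (q - 3) ∣ 2 ^ ((q + 1) * (q + 1)) := by
        have h4 := Nat.dvd_sub (Nat.gcd_dvd_left (q + 1) (q - 3)) (Nat.gcd_dvd_right (q + 1) (q - 3))
        rw [show q + 1 - (q - 3) = 2 ^ 2 by omega] at h4
        exact h4.trans (pow_dvd_pow 2 (by nlinarith))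
      have hle : (q + 1).pred * (q - 3).pred ≤ 2 ^ ((q + 1) * (q + 1)) :=
        (Nat.mul_le_mul (Nat.pred_le _) ((Nat.pred_le _).trans (by omega))).trans
          Nat.lt_two_pow_self.le
      obtain ⟨a, b, hab⟩ := Nat.exists_add_mul_eq_of_gcd_dvd_of_mul_pred_le _ _ _ hdvd hle
      have h1 : a ≤ a * (q + 1) := Nat.le_mul_of_pos_right _ (by omega)
      have h2 : b ≤ b * (q - 3) := Nat.le_mul_of_pos_right _ (by omega)
      exact ⟨_, a, b, 2 ^ ((q + 1) * (q + 1)) - (a + b), hab, by omega⟩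
  refine ⟨s, ?_⟩
  set J : Matrix F F ℝ := of fun _ _ => 1 with hJ
  set B : Matrix F F ℝ := J - (2 : ℝ) • 1 with hB
  set C := paley F 1 with hC
  set D := paley F (-quadraticChar F (-1)) with hD
  have hJt : Jᵀ = J := rfl
  have hBt : Bᵀ = B := by simp [hB, hJt]
  have hJJ : J * J = (q : ℝ) • J := by ext; simp [hJ, Matrix.mul_apply, hq]
  have hJP : ∀ e, J * (paley F e)ᵀ = paley F e * J := by
    intro e
    ext x y
    simp [hJ, Matrix.mul_apply, sum_paley hF]
  have hBP : ∀ e, B * (paley F e)ᵀ = paley F e * B := by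
    intro e
    rw [hB, sub_mul, mul_sub, hJP, paley_transpose]
    simp
  have hJB : J * B = B * J := by simp [hB, sub_mul, mul_sub]
  have hBB : B * B = ((q : ℝ) - 4) • J + (4 : ℝ) • 1 := by
    simp only [hB, sub_mul, mul_sub, hJJ, smul_mul_assoc, mul_smul_comm, one_mul, mul_one]
    module
  have hJs : IsSignMatrix J := fun _ _ => by simp [hJ]
  have hBs : IsSignMatrix B := by
    intro x y
    by_cases h : x = y
    · subst h; right; simp [hB, hJ]; norm_num
    · left; simp [hB, hJ, h]
  have hCs : IsSignMatrix C := isSignMatrix_paley (by norm_num)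
  have hDs : IsSignMatrix D :=
    isSignMatrix_paley (by rw [neg_mul_neg, quadraticChar_neg_one_mul_self])
  have hCD : C * Dᵀ = D * Cᵀ := paley_amicable hF
  have key := HasDesign.of_sum_eq s a b c habc (F ⊕ F) (dup J) (dup B) (rot C D) hJs.dup hBs.dup
    (hCs.rot hDs) (dup_dup_amicable (by rw [hJt, hBt, hJB]))
    (rot_dup_amicable (by rw [hJt, hC, hJP]) (by rw [hJt, hD, hJP])).symm
    (rot_dup_amicable (by rw [hBt, hC, hBP]) (by rw [hBt, hD, hBP])).symm
    (8 * b + 2 * c * (q + 1)) ?_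
  · simpa [pow_succ, mul_assoc, two_mul, mul_add, hq] using key
  · have hcoef : (a : ℝ) * q + b * (q - 4) = c := by
      have h1 : (a : ℝ) * (q + 1) + b * (q - 3) = 2 ^ s := by
        rw [← Nat.cast_ofNat (n := 3), ← Nat.cast_sub hq3]
        exact_mod_cast hab
      have h2 : (a : ℝ) + b + c = 2 ^ s := by exact_mod_cast habc
      linear_combination h1 - h2
    rw [dup_mul_transpose_dup, dup_mul_transpose_dup, rot_mul_transpose_rot hCD,
      paley_gram_add hF, hJt, hBt, hJJ, hBB, ← hq, ← hJ]
    simp only [fromBlocks_smul, fromBlocks_add, ← fromBlocks_one, smul_zero, add_zero, ← hcoef]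
    congr 1 <;> module

end Paley

theorem exists_hadamardOrder_of_prime {q : ℕ} (hq : q.Prime) :
    ∃ t, 0 < t ∧ HadamardOrder (2 ^ t * q) := by
  have := Fact.mk hq
  rcases eq_or_ne q 2 with rfl | h2
  · exact ⟨1, one_pos, by simpa [pow_succ] using hadamardOrder_two_pow 2⟩
  · obtain ⟨s, hs⟩ := exists_hadamardOrder_of_ringChar_ne_two (F := ZMod q)
      (by rwa [ZMod.ringChar_zmod_n])
    exact ⟨s + 1, s.succ_pos, by rwa [ZMod.card] at hs⟩

/-! ### The sheared block matrices -/

section QuasiUnbiased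

variable {F V : Type*} [Field F] [Fintype F] [DecidableEq F] [Fintype V] [DecidableEq V]

/-- The block matrix whose block at block row `(u, v)` and block column `k` is the outer product of
column `k` of `R` with row `(u + x * k, v)` of `K`. -/
def shear (R : Matrix F F ℝ) (K : Matrix (F × V) (F × V) ℝ) (x : F) :
    Matrix ((F × V) × F) (F × F × V) ℝ :=
  of fun r c => R r.2 c.1 * K (r.1.1 + x * c.1, r.1.2) c.2

theorem shear_mul_transpose {R : Matrix F F ℝ} {K : Matrix (F × V) (F × V) ℝ} {N : ℝ}
    (hK : K * Kᵀ = N • 1) (x y : F) (r r' : (F × V) × F) :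
    (shear R K x * (shear R K y)ᵀ) r r' = ∑ k, R r.2 k * R r'.2 k *
      (if r.1.1 + x * k = r'.1.1 + y * k ∧ r.1.2 = r'.1.2 then N else 0) := by
  rw [Matrix.mul_apply, Fintype.sum_prod_type]
  refine Finset.sum_congr rfl fun k _ => ?_
  have h := congrFun (congrFun hK (r.1.1 + x * k, r.1.2)) (r'.1.1 + y * k, r'.1.2)
  simp only [Matrix.mul_apply, transpose_apply, Matrix.smul_apply, Matrix.one_apply, Prod.mk.injEq,
    smul_eq_mul, mul_ite, mul_one, mul_zero] at h
  rw [← h, Finset.mul_sum]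
  refine Finset.sum_congr rfl fun c _ => ?_
  simp only [shear, of_apply, transpose_apply]
  ring

theorem shear_gram {R : Matrix F F ℝ} {K : Matrix (F × V) (F × V) ℝ} {M N : ℝ}
    (hR : R * Rᵀ = M • 1) (hK : K * Kᵀ = N • 1) (x : F) :
    shear R K x * (shear R K x)ᵀ = (M * N) • 1 := by
  ext ⟨⟨u, v⟩, α⟩ ⟨⟨u', v'⟩, α'⟩
  have h := congrFun (congrFun hR α) α'
  simp only [Matrix.mul_apply, transpose_apply, Matrix.smul_apply, Matrix.one_apply,
    smul_eq_mul] at h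
  rw [shear_mul_transpose hK]
  simp only [add_left_inj]
  rw [← Finset.sum_mul, h]
  simp only [Matrix.smul_apply, Matrix.one_apply, Prod.mk.injEq, smul_eq_mul]
  split_ifs <;> simp_all

/-- For `x ≠ y` at most one block column contributes to an entry of the product: the one at the
unique `k` with `u + x * k = u' + y * k`. -/
theorem shear_cross_entry {R : Matrix F F ℝ} {K : Matrix (F × V) (F × V) ℝ} {N : ℝ}
    (hR : IsSignMatrix R) (hK : K * Kᵀ = N • 1) {x y : F} (hxy : x ≠ y) (r r' : (F × V) × F) :
    (shear R K x * (shear R K y)ᵀ) r r' = 0 ∨ (shear R K x * (shear R K y)ᵀ) r r' = N ∨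
      (shear R K x * (shear R K y)ᵀ) r r' = -N := by
  have hd : x - y ≠ 0 := sub_ne_zero.2 hxy
  rw [shear_mul_transpose hK]
  have hk : ∀ k, (r.1.1 + x * k = r'.1.1 + y * k) ↔ k = (r'.1.1 - r.1.1) / (x - y) := by
    intro k
    rw [eq_div_iff hd]
    constructor <;> intro h <;> linear_combination h
  by_cases hv : r.1.2 = r'.1.2
  · right
    simp only [hk, hv, and_true, mul_ite, mul_zero, Finset.sum_ite_eq', Finset.mem_univ, if_true]
    rcases hR r.2 ((r'.1.1 - r.1.1) / (x - y)) with h | h <;>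
      rcases hR r'.2 ((r'.1.1 - r.1.1) / (x - y)) with h' | h' <;> simp [h, h']
  · left
    simp [hv]

end QuasiUnbiased

/-- A Hadamard matrix of order `2 ^ t * q` yields `2 ^ t` distinct mutually quasi-unbiased Hadamard
matrices, one for each shear parameter in the field with `2 ^ t` elements. -/
theorem exists_mutuallyQuasiUnbiased {t q : ℕ} (ht : 0 < t) (hq : 0 < q)
    (hK : HadamardOrder (2 ^ t * q)) :
    ∃ H : Fin (2 ^ t) → Matrix (Fin (2 ^ (2 * t) * q)) (Fin (2 ^ (2 * t) * q)) ℝ,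
      Function.Injective H ∧ (∀ i, (H i).IsHadamard) ∧
      MutuallyQuasiUnbiased (2 ^ (2 * t) * q) (2 ^ (2 * t) * q) (2 ^ (2 * t))
        ((2 : ℝ) ^ (2 * t) * (q : ℝ) ^ 2) H := by
  classical
  let F := GaloisField 2 t
  let _ : Fintype F := Fintype.ofFinite F
  have hF : Fintype.card F = 2 ^ t := by
    rw [← Nat.card_eq_fintype_card]
    exact GaloisField.card 2 t ht.ne'
  obtain ⟨R, hRs, hR⟩ := (hadamardOrder_two_pow t).exists_index F hF
  obtain ⟨K, hKs, hK⟩ := hK.exists_index (F × Fin q) (by simp [hF])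
  let e : Fin (2 ^ t) ≃ F := Fintype.equivOfCardEq (by simp [hF])
  let r : Fin (2 ^ (2 * t) * q) ≃ (F × Fin q) × F :=
    Fintype.equivOfCardEq (by simp [hF]; ring)
  let c : Fin (2 ^ (2 * t) * q) ≃ F × F × Fin q :=
    Fintype.equivOfCardEq (by simp [hF]; ring)
  let H : Fin (2 ^ t) → Matrix (Fin (2 ^ (2 * t) * q)) (Fin (2 ^ (2 * t) * q)) ℝ :=
    fun i => (shear R K (e i)).submatrix r c
  have hq' : (0 : ℝ) < q := by exact_mod_cast hq
  have hprod : ∀ i j, H i * (H j)ᵀ = (shear R K (e i) * (shear R K (e j))ᵀ).submatrix r r :=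
    fun i j => by simp only [H, transpose_submatrix, submatrix_mul_equiv]
  have hsign : ∀ i, IsSignMatrix (H i) := fun i a b => by
    rcases hRs (r a).2 (c b).1 with h | h <;>
      rcases hKs ((r a).1.1 + e i * (c b).1, (r a).1.2) (c b).2 with h' | h' <;>
      simp [H, shear, h, h']
  have hgram : ∀ i, H i * (H i)ᵀ = ((2 ^ (2 * t) * q : ℕ) : ℝ) • 1 := fun i => by
    rw [hprod, shear_gram hR hK, submatrix_smul, Pi.smul_apply, Pi.smul_apply, submatrix_one_equiv]
    congr 1
    push_cast
    ring
  have : Nonempty (Fin (2 ^ (2 * t) * q)) := ⟨⟨0, by positivity⟩⟩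
  have hhad : ∀ i, (H i).IsHadamard := fun i =>
    isHadamard_of_mul_transpose (hsign i) (by rw [hgram, Fintype.card_fin])
  have hgram' : ∀ i, (H i)ᵀ * H i = ((2 ^ (2 * t) * q : ℕ) : ℝ) • 1 := fun i => by
    simpa using (hhad i).conjTranspose_mul
  have hweigh : ∀ i, IsWeighing (2 ^ (2 * t) * q) (H i) := fun i =>
    ⟨fun a b => Or.inr (hsign i a b), hgram i⟩
  have hsqrt : Real.sqrt ((2 : ℝ) ^ (2 * t) * (q : ℝ) ^ 2) = 2 ^ t * q := by
    rw [mul_comm 2 t, pow_mul, ← mul_pow, Real.sqrt_sq (by positivity)]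
  have hpair : ∀ i j, i ≠ j → QuasiUnbiased (2 ^ (2 * t) * q) (2 ^ (2 * t) * q) (2 ^ (2 * t))
      ((2 : ℝ) ^ (2 * t) * (q : ℝ) ^ 2) (H i) (H j) := fun i j hij => by
    refine ⟨by positivity, hweigh i, hweigh j, ?_, ?_⟩
    · intro a b
      rw [hsqrt, hprod, Matrix.smul_apply, submatrix_apply, smul_eq_mul]
      rcases shear_cross_entry hRs hK (e.injective.ne hij) (r a) (r b) with h | h | h
      · left; rw [h, mul_zero]
      · right; left; rw [h]; push_cast; field_simp
      · right; right; rw [h]; push_cast; field_simp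
    · rw [hsqrt, transpose_smul, transpose_mul, transpose_transpose, smul_mul_assoc,
        mul_smul_comm, smul_smul, Matrix.mul_assoc, ← Matrix.mul_assoc (H j)ᵀ, hgram',
        smul_mul_assoc, Matrix.one_mul, mul_smul_comm, hgram, smul_smul, smul_smul]
      congr 1
      push_cast
      field_simp
      ring
  refine ⟨H, fun i j hij => ?_, hhad, hweigh, hpair⟩
  -- If two members coincided, `1 / √a` times their product would have the diagonal entry `2 ^ t > 1`.
  by_contra hne
  have a : Fin (2 ^ (2 * t) * q) := Classical.arbitrary _
  have hent := (hpair i j hne).weighing.entries a a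
  rw [← hij, hgram, hsqrt] at hent
  have hval : 1 / ((2 : ℝ) ^ t * q) * ((2 ^ (2 * t) * q : ℕ) : ℝ) = 2 ^ t := by
    push_cast
    field_simp
    ring
  simp only [Matrix.smul_apply, Matrix.one_apply_eq, smul_eq_mul, mul_one, hval] at hent
  have h1 : (1 : ℝ) < 2 ^ t := one_lt_pow₀ one_lt_two ht.ne'
  rcases hent with h | h | h <;> linarith

theorem mainTheorem4 (q : ℕ) (hq : q.Prime) :
    ∃ t : ℕ, 0 < t ∧
      ∃ H : Fin (2 ^ t) → Matrix (Fin (2 ^ (2 * t) * q)) (Fin (2 ^ (2 * t) * q)) ℝ,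
        Function.Injective H ∧
        (∀ i, (H i).IsHadamard) ∧
        MutuallyQuasiUnbiased (2 ^ (2 * t) * q) (2 ^ (2 * t) * q) (2 ^ (2 * t))
          ((2 : ℝ) ^ (2 * t) * (q : ℝ) ^ 2) H := by
  obtain ⟨t, ht, hK⟩ := exists_hadamardOrder_of_prime hq
  exact ⟨t, ht, exists_mutuallyQuasiUnbiased ht hq.pos hK⟩
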